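/- Let $\mathfrak b$ be the least cardinality of a family of functions $\omega\to\omega$ that is not bounded by a single function with respect to eventual domination, let $\mathfrak c=2^{\aleph_0}$, and assume $\mathfrak b=\mathfrak c$. Then for every ordinal $\xi$ with $1\le\xi\le\omega_1$ the class $\mathcal P_\xi$ of the P-hierarchy of ultrafilters on $\omega$ is nonempty, where the P-hierarchy is defined as follows. A sequential cascade is a tree $V$ with a least element $\emptyset_V$ and without infinite branches in which every non-maximal element $v$ has a countably infinite set $v^+$ of immediate successors; its set $\max V$ of maximal elements is a subset of $\omega$. The rank of $v\in V$ is $r(v)=0$ if $v\in\max V$, and otherwise the least ordinal greater than $r(w)$ for all $w\in v^+$; the rank of $V$ is $r(V)=r(\emptyset_V)$. The cascade is monotone if for every non-maximal $v$ the set $v^+$ can be ordered in type $\omega$ so that the ranks of its elements are non-decreasing. The contour $\int V$ is the filter on $\omega$ defined by recursion: if $V$ has a single element $x$, then $\int V=\{A\subseteq\omega: x\in A\}$; otherwise, writing $V_w$ for the subtree of elements above or equal to $w$, $$\int V=\Big\{A\subseteq\omega:\ A\in\int V_w\ \text{for all but finitely many } w\in\emptyset_V^+\Big\}.$$ (In particular,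 if $r(V)=1$, then $\int V$ is the cofinite filter on $\max V$.) A monotone sequential contour of rank $\alpha\ge 1$ is $\int V$ for a monotone sequential cascade $V$ of rank $\alpha$. An ultrafilter $u$ on $\omega$ belongs to $\mathcal P_\xi$ if 1. for each $\beta$ with $1\le\beta<\xi$ some monotone sequential contour of rank $\beta$ is contained in $u$, and 2. no monotone sequential contour of rank $\xi$ is contained in $u$. -/

import Mathlib

/-- The bounding number: the least cardinality of a family of functions `ω → ω` that is
unbounded for eventual domination. -/
noncomputable def boundingNumber : Cardinal.{0} :=
  sInf {κ | ∃ F : Set (ℕ → ℕ),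
    Cardinal.mk F = κ ∧ ¬ ∃ g : ℕ → ℕ, ∀ f ∈ F, ∀ᶠ n in Filter.atTop, f n ≤ g n}

/-- Sequential trees without infinite branches whose maximal elements carry natural numbers.
`leaf x` is the one-element tree; `node V` is the tree whose root has the infinitely many immediate
successors indexed by `n : ℕ`, the `n`-th being the root of `V n`. Every tree of this inductive
type is well-founded. That the maximal elements are pairwise different natural numbers
is required separately, in `SeqTree.IsCascade`. -/
inductive SeqTree : Type
  | leaf (x : ℕ) : SeqTree
  | node (V : ℕ → SeqTree) : SeqTree

namespace SeqTree

/-- The set `max V` of maximal elements, as a subset of `ω`. -/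
def max : SeqTree → Set ℕ
  | leaf x => {x}
  | node V => ⋃ n, (V n).max

/-- `V` is a sequential cascade with `max V ⊆ ω`: different maximal elements of the tree are
different natural numbers. -/
def IsCascade : SeqTree → Prop
  | leaf _ => True
  | node V => (∀ n, (V n).IsCascade) ∧ ∀ m n, m ≠ n → Disjoint (V m).max (V n).max

/-- The rank: `0` at a maximal element, and otherwise the least ordinal greater than the ranks
of all immediate successors. -/
noncomputable def rank : SeqTree → Ordinal.{0}
  | leaf _ => 0
  | node V => ⨆ n, Order.succ (V n).rank

/-- `V` is monotone: the immediate successors of every non-maximal element can be ordered in type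
`ω` so that their ranks are non-decreasing. -/
def IsMonotone : SeqTree → Prop
  | leaf _ => True
  | node V => (∀ n, (V n).IsMonotone) ∧ ∃ σ : Equiv.Perm ℕ, Monotone fun n => (V (σ n)).rank

/-- The contour `∫ V`, as a filter on `ω`. For a non-trivial tree it is the contour of the filters
`∫ (V n)` along the cofinite filter, that is `⋃_{P cofinite} ⋂_{n ∈ P} ∫ (V n)`; at a maximal
element it is the principal ultrafilter. In rank `1` this gives the cofinite filter on `max V`. -/
def contour : SeqTree → Filter ℕ
  | leaf x => pure x
  | node V => Filter.bind Filter.cofinite fun n => (V n).contour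

end SeqTree

/-- The ultrafilter `u` contains a monotone sequential contour of rank `α`. -/
def ContainsContourOfRank (u : Ultrafilter ℕ) (α : Ordinal.{0}) : Prop :=
  ∃ V : SeqTree, V.IsCascade ∧ V.IsMonotone ∧ V.rank = α ∧ ∀ A ∈ V.contour, A ∈ u

/-- The class `𝒫_α` of the P-hierarchy. Contours have rank at least `1`, so `β` ranges
over `1 ≤ β < α`. -/
def PClass (α : Ordinal.{0}) : Set (Ultrafilter ℕ) :=
  {u | (∀ β, 1 ≤ β → β < α → ContainsContourOfRank u β) ∧ ¬ ContainsContourOfRank u α}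

open Filter Set


/-! ### Cascades and their contours. -/

namespace SeqTree

/-! The filter `iterLim δ`, got by iterating "limit of copies", contains some monotone contour of
every rank `β` with `1 ≤ β < 1 + δ` (`exists_contour_ge_copiesLim_iterLim`). For countable `δ`, no
positive trace of it contains one of rank at least `1 + δ` (`escapes_map_iterLim`).

For `0 < δ < ω₁`, a recursion of length `𝔠 = 𝔟` refines `iterLim δ`, adding for each monotone
cascade of rank `1 + δ` the complement of a member of its contour
(`exists_ultrafilter_forall_exists_mem`). A step cannot fail: fewer than `𝔟` sets have been added,
and each finite intersection of them escapes some `C t` lying in the contours of all immediate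
subtrees (`escapesTails_iterLim`). A pseudo-intersection `D` of the `C t` lies in the contour, yet
almost contains none of these intersections (`EscapesTails.exists_mem_contour_neBot`).

At `ξ = 1` a principal ultrafilter works; at `ξ = ω₁` any refinement of `iterLim ω₁` does, since
cascades have countable rank. -/

theorem mem_contour_node {V : ℕ → SeqTree} {A : Set ℕ} :
    A ∈ (node V).contour ↔ ∀ᶠ n in atTop, A ∈ (V n).contour := by
  rw [contour, mem_bind', Nat.cofinite_eq_atTop]
  rfl

theorem max_mem_contour (V : SeqTree) : V.max ∈ V.contour := by
  induction V with
  | leaf x => simp [max, contour]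
  | node V ih =>
    refine mem_contour_node.2 (Eventually.of_forall fun n => mem_of_superset (ih n) ?_)
    exact subset_iUnion (fun n => (V n).max) n

theorem rank_lt_rank_node (V : ℕ → SeqTree) (n : ℕ) : (V n).rank < (node V).rank :=
  (Order.lt_succ _).trans_le (Ordinal.le_iSup (fun n => Order.succ (V n).rank) n)

theorem rank_lt_omega_one (V : SeqTree) : V.rank < Ordinal.omega 1 := by
  induction V with
  | leaf x => simpa [rank] using Ordinal.omega_pos 1
  | node V ih =>
    refine Ordinal.iSup_lt_omega_one fun n => ?_
    exact (Cardinal.isSuccLimit_omega 1).succ_lt (ih n)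

theorem IsMonotone.eventually_le_rank {V : ℕ → SeqTree} (hV : (node V).IsMonotone)
    {γ : Ordinal.{0}} (hγ : γ < (node V).rank) : ∀ᶠ n in atTop, γ ≤ (V n).rank := by
  obtain ⟨-, σ, hσ⟩ := hV
  obtain ⟨n, hn⟩ := Ordinal.lt_iSup_iff.1 hγ
  have h : ∀ᶠ m in cofinite, σ.symm n ≤ σ.symm m :=
    σ.symm.injective.tendsto_cofinite.eventually
      (Nat.cofinite_eq_atTop ▸ eventually_ge_atTop (σ.symm n))
  rw [← Nat.cofinite_eq_atTop]
  filter_upwards [h] with m hm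
  refine (Order.lt_succ_iff.1 hn).trans ?_
  simpa using hσ hm

theorem exists_eq_node_of_one_le_rank {V : SeqTree} (h : 1 ≤ V.rank) : ∃ W, V = node W := by
  cases V with
  | leaf x => simp [rank] at h
  | node W => exact ⟨W, rfl⟩

/-- The maximal elements lying above all but the first `m` successors of the root of `node V`. -/
def tailMax (V : ℕ → SeqTree) (m : ℕ) : Set ℕ := {x | ∃ n, m ≤ n ∧ x ∈ (V n).max}

theorem tailMax_anti (V : ℕ → SeqTree) {m n : ℕ} (h : m ≤ n) : tailMax V n ⊆ tailMax V m :=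
  fun _ ⟨k, hk, hx⟩ => ⟨k, h.trans hk, hx⟩

theorem max_subset_tailMax (V : ℕ → SeqTree) {m n : ℕ} (h : m ≤ n) : (V n).max ⊆ tailMax V m :=
  fun _ hx => ⟨n, h, hx⟩

theorem tailMax_mem_contour (V : ℕ → SeqTree) (m : ℕ) : tailMax V m ∈ (node V).contour := by
  refine mem_contour_node.2 ?_
  filter_upwards [eventually_ge_atTop m] with n hn
  exact mem_of_superset (max_mem_contour _) (max_subset_tailMax V hn)

theorem IsCascade.eq_of_mem_max {V : ℕ → SeqTree} (hV : (node V).IsCascade) {m n x : ℕ}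
    (hm : x ∈ (V m).max) (hn : x ∈ (V n).max) : m = n := by
  by_contra h
  exact disjoint_left.1 (hV.2 m n h) hm hn

theorem IsCascade.max_subset_compl_max {V : ℕ → SeqTree} (hV : (node V).IsCascade) {m n : ℕ}
    (h : m ≠ n) : (V m).max ⊆ (V n).maxᶜ :=
  fun _ hm hn => h (hV.eq_of_mem_max hm hn)

/-- The contour of a tree is the image of `ℕ → ℕ` under an antitone cofinal map. -/
theorem exists_antitone_cofinal (V : SeqTree) : ∃ c : (ℕ → ℕ) → Set ℕ,
    Antitone c ∧ (∀ f, c f ∈ V.contour) ∧ ∀ C ∈ V.contour, ∃ f, c f ⊆ C := by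
  induction V with
  | leaf x =>
    exact ⟨fun _ => {x}, antitone_const, fun _ => by simp [contour],
      fun C hC => ⟨0, by simpa [contour] using hC⟩⟩
  | node V ih =>
    choose c hanti hmem hcof using ih
    -- `f 0` says how many subtrees to drop; the remaining values code one function for each
    -- subtree.
    refine ⟨fun f => ⋃ n, ⋃ (_ : f 0 ≤ n), c n fun i => f (Nat.pair n i + 1), ?_, ?_, ?_⟩
    · intro f g hfg
      refine iUnion_mono fun n => iUnion_subset fun hn => ?_
      exact subset_iUnion_of_subset ((hfg 0).trans hn) (hanti n fun i => hfg _)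
    · intro f
      refine mem_contour_node.2 ?_
      filter_upwards [eventually_ge_atTop (f 0)] with n hn
      exact mem_of_superset (hmem n _)
        (subset_iUnion_of_subset n (subset_iUnion_of_subset hn subset_rfl))
    · intro C hC
      obtain ⟨k, hk⟩ := eventually_atTop.1 (mem_contour_node.1 hC)
      have : ∀ n, ∃ f, k ≤ n → c n f ⊆ C := fun n => by
        by_cases h : k ≤ n
        · obtain ⟨f, hf⟩ := hcof n C (hk n h)
          exact ⟨f, fun _ => hf⟩
        · exact ⟨0, fun h' => absurd h' h⟩
      choose F hF using this
      refine ⟨fun i => Nat.casesOn i k fun j => F j.unpair.1 j.unpair.2, ?_⟩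
      refine iUnion_subset fun n => iUnion_subset fun hn => ?_
      simpa using hF n hn

end SeqTree

open SeqTree

/-! ### Pseudo-intersections below the bounding number. -/

theorem exists_eventual_bound {I : Type} (hI : Cardinal.mk I < boundingNumber) (f : I → ℕ → ℕ) :
    ∃ g : ℕ → ℕ, ∀ i, ∀ᶠ n in atTop, f i n ≤ g n := by
  by_contra h
  refine absurd (csInf_le' ?_ : boundingNumber ≤ Cardinal.mk (range f))
    (not_le.2 (Cardinal.mk_range_le.trans_lt hI))
  refine ⟨range f, rfl, fun ⟨g, hg⟩ => h ⟨g, fun i => hg _ ⟨i, rfl⟩⟩⟩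

/-- Fewer than `𝔟` sets, each in the contour of every immediate subtree, have a common
pseudo-intersection with the same property. -/
theorem SeqTree.IsCascade.exists_pseudointersection {V : ℕ → SeqTree} (hV : (node V).IsCascade)
    {I : Type} (hI : Cardinal.mk I < boundingNumber) (C : I → Set ℕ)
    (hC : ∀ i n, C i ∈ (V n).contour) :
    ∃ D : Set ℕ, (∀ n, D ∈ (V n).contour) ∧ ∀ i, ∃ m, D ∩ tailMax V m ⊆ C i := by
  choose c hanti hmem hcof using fun n => (V n).exists_antitone_cofinal
  choose F hF using fun i n => hcof n (C i) (hC i n)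
  obtain ⟨g, hg⟩ := exists_eventual_bound hI fun i j => F i j.unpair.1 j.unpair.2
  refine ⟨⋃ n, c n (fun k => g (Nat.pair n k)) ∩ (V n).max, fun n => ?_, fun i => ?_⟩
  · exact mem_of_superset (inter_mem (hmem n _) (max_mem_contour _))
      (subset_iUnion (fun n => c n (fun k => g (Nat.pair n k)) ∩ (V n).max) n)
  -- Since `n ≤ Nat.pair n k`, one eventual bound over the codes is a bound for all `k` at once as
  -- soon as `m ≤ n`.
  · obtain ⟨m, hm⟩ := eventually_atTop.1 (hg i)
    refine ⟨m, ?_⟩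
    rintro x ⟨hx, n', hn', hxn'⟩
    obtain ⟨n, hx, hxn⟩ := mem_iUnion.1 hx
    obtain rfl := hV.eq_of_mem_max hxn hxn'
    refine hF i n (hanti n (fun k => ?_) hx)
    simpa using hm _ (hn'.trans (Nat.left_le_pair n k))

/-! ### Escaping contours, and passage to limits of filters. -/

/-- No `H`-positive trace of `H` contains a monotone contour of rank at least `α`. -/
def Escapes (H : Filter ℕ) (α : Ordinal.{0}) : Prop :=
  ∀ V : SeqTree, V.IsCascade → V.IsMonotone → α ≤ V.rank →
    ∀ A : Set ℕ, (∃ᶠ x in H, x ∈ A) → ∃ C ∈ V.contour, ∃ᶠ x in H, x ∈ A \ C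

/-- The strengthening of `Escapes` in which the witness belongs to the contour of every immediate
subtree and works on every tail of the cascade. -/
def EscapesTails (H : Filter ℕ) (α : Ordinal.{0}) : Prop :=
  ∀ V : ℕ → SeqTree, (node V).IsCascade → (node V).IsMonotone → α ≤ (node V).rank →
    ∀ B : Set ℕ, (∀ m, ∃ᶠ x in H, x ∈ B ∩ tailMax V m) →
      ∃ C, (∀ n, C ∈ (V n).contour) ∧ ∀ m, ∃ᶠ x in H, x ∈ (B ∩ tailMax V m) \ C

theorem EscapesTails.escapes {H : Filter ℕ} {α : Ordinal.{0}} (h : EscapesTails H α)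
    (hα : 1 ≤ α) : Escapes H α := by
  intro V hc hm hr A hA
  obtain ⟨V, rfl⟩ := exists_eq_node_of_one_le_rank (hα.trans hr)
  by_cases hB : ∀ m, ∃ᶠ x in H, x ∈ A ∩ tailMax V m
  · obtain ⟨C, hC, hf⟩ := h V hc hm hr A hB
    exact ⟨C, mem_contour_node.2 (Eventually.of_forall hC),
      (hf 0).mono fun x hx => ⟨hx.1.1, hx.2⟩⟩
  · push Not at hB
    obtain ⟨m, hB⟩ := hB
    refine ⟨tailMax V m, tailMax_mem_contour V m, (hA.and_eventually hB).mono ?_⟩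
    exact fun x hx => ⟨hx.1, fun ht => hx.2 ⟨hx.1, ht⟩⟩

/-- If `B` is positive on one late subtree, escape there and add everything outside that subtree.
Otherwise escape the whole tree; the finitely many subtrees whose contours may miss the witness can
be added entirely, because `B` is null on those in the tail. -/
theorem Escapes.exists_mem_forall_contour {H : Filter ℕ} {γ : Ordinal.{0}} (hH : Escapes H γ)
    {V : ℕ → SeqTree} (hc : (node V).IsCascade) (hm : (node V).IsMonotone) {m : ℕ}
    (hr : ∀ n, m ≤ n → γ ≤ (V n).rank) {B : Set ℕ} (hB : ∃ᶠ x in H, x ∈ B ∩ tailMax V m) :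
    ∃ C, (∀ n, C ∈ (V n).contour) ∧ (∀ n < m, (V n).max ⊆ C) ∧
      ∃ᶠ x in H, x ∈ (B ∩ tailMax V m) \ C := by
  by_cases hn : ∃ n, m ≤ n ∧ ∃ᶠ x in H, x ∈ B ∩ (V n).max
  · obtain ⟨n, hmn, hf⟩ := hn
    obtain ⟨C, hC, hf⟩ := hH (V n) (hc.1 n) (hm.1 n) (hr n hmn) _ hf
    refine ⟨C ∪ (V n).maxᶜ, fun j => ?_, fun j hj => ?_, ?_⟩
    · obtain rfl | hj := eq_or_ne j n
      · exact mem_of_superset hC subset_union_left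
      · exact mem_of_superset (max_mem_contour _)
          ((hc.max_subset_compl_max hj).trans subset_union_right)
    · exact (hc.max_subset_compl_max (hj.trans_le hmn).ne).trans subset_union_right
    · refine hf.mono fun x hx => ⟨⟨hx.1.1, n, hmn, hx.1.2⟩, ?_⟩
      rintro (h | h)
      exacts [hx.2 h, h hx.1.2]
  · push Not at hn
    obtain ⟨C, hC, hf⟩ := hH (node V) hc hm
      ((hr m le_rfl).trans (rank_lt_rank_node V m).le) _ hB
    obtain ⟨k, hk⟩ := eventually_atTop.1 (mem_contour_node.1 hC)
    refine ⟨C ∪ ⋃ n ∈ Iio (m + k), (V n).max, fun j => ?_, fun j hj => ?_, ?_⟩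
    · by_cases hj : k ≤ j
      · exact mem_of_superset (hk j hj) subset_union_left
      · refine mem_of_superset (max_mem_contour _) (subset_union_of_subset_right ?_ _)
        exact subset_biUnion_of_mem (u := fun n => (V n).max) (show j ∈ Iio (m + k) by
          simp only [mem_Iio]; omega)
    · refine subset_union_of_subset_right ?_ _
      exact subset_biUnion_of_mem (u := fun n => (V n).max) (show j ∈ Iio (m + k) by
        simp only [mem_Iio]; omega)
    · have hnull : ∀ᶠ x in H, ∀ n ∈ Iio (m + k), m ≤ n → x ∉ B ∩ (V n).max :=
        (eventually_all_finite (finite_Iio _)).2 fun n _ => by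
          by_cases h : m ≤ n
          · exact (hn n h).mono fun x hx _ => hx
          · exact Eventually.of_forall fun x h' => absurd h' h
      refine (hf.and_eventually hnull).mono ?_
      rintro x ⟨⟨⟨hxB, n, hmn, hxn⟩, hxC⟩, hx⟩
      refine ⟨⟨hxB, n, hmn, hxn⟩, ?_⟩
      rintro (h | h)
      · exact hxC h
      · obtain ⟨j, hj, hxj⟩ := mem_iUnion₂.1 h
        obtain rfl := hc.eq_of_mem_max hxn hxj
        exact hx n hj hmn ⟨hxB, hxn⟩

/-- Diagonalisation: one escape for each of infinitely many `K k`, then the intersection of all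
witnesses. -/
theorem exists_escape_tails_of_bind_le {H : Filter ℕ} {K : ℕ → Filter ℕ} (hK : atTop.bind K ≤ H)
    {V : ℕ → SeqTree} (hc : (node V).IsCascade) (hm : (node V).IsMonotone) {B : Set ℕ}
    (h : ∀ m, ∃ k, m ≤ k ∧ ∃ j, m ≤ j ∧ ∃ γ, Escapes (K k) γ ∧ (∀ n, j ≤ n → γ ≤ (V n).rank) ∧
      ∃ᶠ x in K k, x ∈ B ∩ tailMax V j) :
    ∃ C, (∀ n, C ∈ (V n).contour) ∧ ∀ m, ∃ᶠ x in H, x ∈ (B ∩ tailMax V m) \ C := by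
  choose k hk j hj γ hγ hr hf using h
  choose C hC hsub hf using fun m => (hγ m).exists_mem_forall_contour hc hm (hr m) (hf m)
  refine ⟨⋂ m, C m, fun n => ?_, fun m => ?_⟩
  · have : (⋂ m ∈ Iic n, C m) ∩ (V n).max ∈ (V n).contour :=
      inter_mem ((biInter_mem (finite_Iic n)).2 fun m _ => hC m n) (max_mem_contour _)
    -- For `m > n` the set `C m` contains all of `(V n).max`, so only finitely many `C m` cut the
    -- `n`-th subtree.
    refine mem_of_superset this fun x hx => mem_iInter.2 fun m => ?_
    by_cases hmn : m ≤ n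
    · exact mem_iInter₂.1 hx.1 m hmn
    · exact hsub m n ((not_le.1 hmn).trans_le (hj m)) hx.2
  · refine Frequently.filter_mono ?_ hK
    intro hev
    rw [eventually_bind] at hev
    obtain ⟨l, hl⟩ := eventually_atTop.1 hev
    -- The index `l + m` puts `k` beyond `l` and the tail beyond `m`.
    refine hf (l + m) ((hl (k (l + m)) ((Nat.le_add_right l m).trans (hk _))).mono ?_)
    intro x hx hx'
    refine hx ⟨⟨hx'.1.1, tailMax_anti V ?_ hx'.1.2⟩, fun h => hx'.2 (mem_iInter.1 h _)⟩
    exact (Nat.le_add_left m l).trans (hj _)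


/-! ### The iterated limit filters. -/

/-- The limit of the copies of `H` on the sets `{Nat.pair n x | x}`. -/
def copiesLim (H : Filter ℕ) : Filter ℕ := atTop.bind fun n => H.map (Nat.pair n)

theorem copiesLim_mono {H K : Filter ℕ} (h : H ≤ K) : copiesLim H ≤ copiesLim K :=
  bind_mono le_rfl (Eventually.of_forall fun _ => map_mono h)

instance (H : Filter ℕ) [H.NeBot] : (copiesLim H).NeBot := by
  refine ⟨fun h => ?_⟩
  have : (∅ : Set ℕ) ∈ copiesLim H := h ▸ mem_bot
  obtain ⟨n, hn⟩ := (Eventually.exists (mem_bind'.1 this) : ∃ n, ∅ ∈ H.map (Nat.pair n))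
  exact empty_notMem _ hn

/-- The transfinite iteration of `copiesLim`, starting from the trivial filter. -/
noncomputable def iterLim (δ : Ordinal.{0}) : Filter ℕ :=
  ⨅ η : Iio δ, copiesLim (iterLim η)
termination_by δ
decreasing_by exact η.2

theorem iterLim_le_copiesLim {η δ : Ordinal.{0}} (h : η < δ) :
    iterLim δ ≤ copiesLim (iterLim η) := by
  rw [iterLim]
  exact iInf_le (fun η : Iio δ => copiesLim (iterLim η)) ⟨η, h⟩

theorem iterLim_antitone : Antitone iterLim := by
  intro η δ h
  conv_rhs => rw [iterLim]
  exact le_iInf fun ζ => iterLim_le_copiesLim (ζ.2.trans_le h)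

theorem iterLim_succ (η : Ordinal.{0}) : iterLim (Order.succ η) = copiesLim (iterLim η) := by
  refine le_antisymm (iterLim_le_copiesLim (Order.lt_succ η)) ?_
  conv_rhs => rw [iterLim]
  exact le_iInf fun ζ => copiesLim_mono (iterLim_antitone (Order.lt_succ_iff.1 ζ.2))

theorem iterLim_zero : iterLim 0 = ⊤ := by
  rw [iterLim]
  exact iInf_eq_top.2 fun ζ => absurd (mem_Iio.1 ζ.2) not_lt_zero

theorem mem_iterLim_of_isSuccLimit {δ : Ordinal.{0}} (hδ : Order.IsSuccLimit δ) {A : Set ℕ} :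
    A ∈ iterLim δ ↔ ∃ η < δ, A ∈ iterLim η := by
  refine ⟨fun h => ?_, fun ⟨η, hη, h⟩ => iterLim_antitone hη.le h⟩
  rw [iterLim] at h
  have : Nonempty (Iio δ) := ⟨0, hδ.bot_lt⟩
  rw [mem_iInf_of_directed] at h
  · obtain ⟨⟨η, hη⟩, h⟩ := h
    exact ⟨Order.succ η, hδ.succ_lt hη, iterLim_succ η ▸ h⟩
  · refine directed_of_isDirected_le fun η ζ h => copiesLim_mono (iterLim_antitone h)

instance (δ : Ordinal.{0}) : (iterLim δ).NeBot := by
  induction δ using WellFoundedLT.induction with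
  | ind δ ih =>
    obtain rfl | ⟨η, rfl⟩ | hδ := Ordinal.zero_or_succ_or_isSuccLimit δ
    · rw [iterLim_zero]
      infer_instance
    · rw [iterLim_succ]
      have := ih η (Order.lt_succ η)
      infer_instance
    · refine ⟨fun h => ?_⟩
      have : (∅ : Set ℕ) ∈ iterLim δ := h ▸ mem_bot
      obtain ⟨η, hη, h⟩ := (mem_iterLim_of_isSuccLimit hδ).1 this
      have := ih η hη
      exact empty_notMem _ h

theorem exists_monotone_cofinal_seq {δ : Ordinal.{0}} (h0 : 0 < δ) (hδ : δ < Ordinal.omega 1) :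
    ∃ f : ℕ → Ordinal.{0}, Monotone f ∧ (∀ n, f n < δ) ∧ ∀ η < δ, ∃ n, η ≤ f n := by
  have hcard : δ.card ≤ Cardinal.aleph0 := by
    rw [Cardinal.lt_omega_iff_card_lt, ← Cardinal.succ_aleph0, Order.lt_succ_iff] at hδ
    exact hδ
  have : Countable (Iio δ) := by
    rw [← Cardinal.mk_le_aleph0_iff, Cardinal.mk_Iio_ordinal]
    simpa [← Ordinal.lift_card] using hcard
  have : Nonempty (Iio δ) := ⟨0, h0⟩
  obtain ⟨e, he⟩ := exists_surjective_nat (Iio δ)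
  refine ⟨fun n => (Finset.range (n + 1)).sup fun i => (e i : Ordinal.{0}), ?_, fun n => ?_,
    fun η hη => ?_⟩
  · intro m n h
    exact Finset.sup_mono (Finset.range_mono (by omega))
  · exact (Finset.sup_lt_iff h0).2 fun i _ => (e i).2
  · obtain ⟨n, hn⟩ := he ⟨η, hη⟩
    refine ⟨n, ?_⟩
    have := Finset.le_sup (f := fun i => (e i : Ordinal.{0})) (Finset.self_mem_range_succ n)
    simpa [hn] using this

/-! ### Iterated limits escape contours of high rank. -/

theorem escapes_map_top (ψ : ℕ → ℕ) : Escapes (map ψ ⊤) 1 := by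
  intro V hc hm hr A hA
  obtain ⟨V, rfl⟩ := exists_eq_node_of_one_le_rank hr
  obtain ⟨y, hy⟩ : ∃ y, ψ y ∈ A := by
    rw [frequently_map, frequently_top] at hA
    exact hA
  suffices h : ∃ C ∈ (node V).contour, ψ y ∉ C by
    obtain ⟨C, hC, hyC⟩ := h
    refine ⟨C, hC, ?_⟩
    rw [frequently_map, frequently_top]
    exact ⟨y, hy, hyC⟩
  by_cases h : ∃ n, ψ y ∈ (V n).max
  · obtain ⟨n, hn⟩ := h
    refine ⟨tailMax V (n + 1), tailMax_mem_contour V _, ?_⟩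
    rintro ⟨j, hj, hyj⟩
    have := hc.eq_of_mem_max hn hyj
    omega
  · refine ⟨tailMax V 0, tailMax_mem_contour V _, ?_⟩
    rintro ⟨j, -, hj⟩
    exact h ⟨j, hj⟩

/-- All maps `ψ` are allowed so that the induction hypothesis covers the copies, through `ψ ∘
Nat.pair n`. -/
theorem escapesTails_map_iterLim_succ {η : Ordinal.{0}}
    (h : ∀ ψ : ℕ → ℕ, Escapes (map ψ (iterLim η)) (1 + η)) (ψ : ℕ → ℕ) :
    EscapesTails (map ψ (iterLim (Order.succ η))) (1 + Order.succ η) := by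
  intro V hc hm hr B hB
  have hbind : map ψ (iterLim (Order.succ η)) =
      atTop.bind fun n => map (ψ ∘ Nat.pair n) (iterLim η) := by
    rw [iterLim_succ, copiesLim, map_bind]
    rfl
  refine exists_escape_tails_of_bind_le hbind.ge hc hm fun m => ?_
  have hlt : 1 + η < (node V).rank :=
    ((add_lt_add_iff_left 1).2 (Order.lt_succ η)).trans_le hr
  obtain ⟨N, hN⟩ := eventually_atTop.1 (hm.eventually_le_rank hlt)
  have hf := hB (m + N)
  rw [hbind] at hf
  have hf : ∃ᶠ k in atTop, ∃ᶠ x in map (ψ ∘ Nat.pair k) (iterLim η),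
      x ∈ B ∩ tailMax V (m + N) := by
    intro hev
    refine hf (eventually_bind.2 (hev.mono fun k hk => ?_))
    exact not_frequently.1 hk
  obtain ⟨k, hk, hf⟩ := (hf.and_eventually (eventually_ge_atTop m)).exists.imp fun _ h => h.symm
  exact ⟨k, hk, m + N, Nat.le_add_right _ _, 1 + η, h _,
    fun n hn => hN n ((Nat.le_add_left _ _).trans hn), hf⟩

theorem escapesTails_map_iterLim_of_isSuccLimit {δ : Ordinal.{0}} (hlim : Order.IsSuccLimit δ)
    (hδ : δ < Ordinal.omega 1)
    (h : ∀ η < δ, ∀ ψ : ℕ → ℕ, Escapes (map ψ (iterLim η)) (1 + η)) (ψ : ℕ → ℕ) :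
    EscapesTails (map ψ (iterLim δ)) (1 + δ) := by
  intro V hc hm hr B hB
  obtain ⟨f, hf, hfδ, hcof⟩ := exists_monotone_cofinal_seq hlim.bot_lt hδ
  have hbind : (atTop.bind fun n => map ψ (iterLim (f n))) ≤ map ψ (iterLim δ) := by
    intro A hA
    obtain ⟨η, hη, hA⟩ := (mem_iterLim_of_isSuccLimit hlim).1 (mem_map.1 hA)
    obtain ⟨n, hn⟩ := hcof η hη
    rw [mem_bind']
    filter_upwards [eventually_ge_atTop n] with k hk
    exact iterLim_antitone (hn.trans (hf hk)) hA
  refine exists_escape_tails_of_bind_le hbind hc hm fun m => ?_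
  have hlt : 1 + f m < (node V).rank := ((add_lt_add_iff_left 1).2 (hfδ m)).trans_le hr
  obtain ⟨N, hN⟩ := eventually_atTop.1 (hm.eventually_le_rank hlt)
  exact ⟨m, le_rfl, m + N, Nat.le_add_right _ _, 1 + f m, h _ (hfδ m) ψ,
    fun n hn => hN n ((Nat.le_add_left _ _).trans hn),
    (hB (m + N)).filter_mono (map_mono (iterLim_antitone (hfδ m).le))⟩

theorem escapes_map_iterLim {δ : Ordinal.{0}} (hδ : δ < Ordinal.omega 1) (ψ : ℕ → ℕ) :
    Escapes (map ψ (iterLim δ)) (1 + δ) := by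
  induction δ using WellFoundedLT.induction generalizing ψ with
  | ind δ ih =>
    obtain rfl | ⟨η, rfl⟩ | hlim := Ordinal.zero_or_succ_or_isSuccLimit δ
    · rw [iterLim_zero, add_zero]
      exact escapes_map_top ψ
    · have h := Order.lt_succ η
      exact (escapesTails_map_iterLim_succ (ih η h (h.trans hδ)) ψ).escapes le_self_add
    · exact (escapesTails_map_iterLim_of_isSuccLimit hlim hδ
        (fun η h => ih η h (h.trans hδ)) ψ).escapes le_self_add

/-- The case `δ = 0` is false: if all `V n` are leaves, a set in every `(V n).contour` contains the
whole of `max`. -/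
theorem escapesTails_iterLim {δ : Ordinal.{0}} (h0 : δ ≠ 0) (hδ : δ < Ordinal.omega 1) :
    EscapesTails (iterLim δ) (1 + δ) := by
  rw [← map_id (f := iterLim δ)]
  obtain rfl | ⟨η, rfl⟩ | hlim := Ordinal.zero_or_succ_or_isSuccLimit δ
  · exact absurd rfl h0
  · exact escapesTails_map_iterLim_succ
      (escapes_map_iterLim ((Order.lt_succ η).trans hδ)) id
  · exact escapesTails_map_iterLim_of_isSuccLimit hlim hδ
      (fun η h => escapes_map_iterLim (h.trans hδ)) id

/-! ### Contours contained in the iterated limits. -/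

namespace SeqTree

/-- Relabelling of the maximal elements. -/
def map (f : ℕ → ℕ) : SeqTree → SeqTree
  | leaf x => leaf (f x)
  | node V => node fun n => (V n).map f

theorem max_map (f : ℕ → ℕ) (V : SeqTree) : (V.map f).max = f '' V.max := by
  induction V with
  | leaf x => simp [map, max]
  | node V ih => simp [map, max, ih, image_iUnion]

theorem rank_map (f : ℕ → ℕ) (V : SeqTree) : (V.map f).rank = V.rank := by
  induction V with
  | leaf x => rfl
  | node V ih => simp [map, rank, ih]

theorem IsCascade.map {f : ℕ → ℕ} (hf : f.Injective) {V : SeqTree} (hV : V.IsCascade) :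
    (V.map f).IsCascade := by
  induction V with
  | leaf x => trivial
  | node V ih =>
    refine ⟨fun n => ih n (hV.1 n), fun m n h => ?_⟩
    rw [max_map, max_map]
    exact disjoint_image_of_injective hf (hV.2 m n h)

theorem IsMonotone.map (f : ℕ → ℕ) {V : SeqTree} (hV : V.IsMonotone) : (V.map f).IsMonotone := by
  induction V with
  | leaf x => trivial
  | node V ih => exact ⟨fun n => ih n (hV.1 n), by simpa only [rank_map] using hV.2⟩

theorem contour_map (f : ℕ → ℕ) (V : SeqTree) : (V.map f).contour = V.contour.map f := by
  induction V with
  | leaf x => simp [map, contour]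
  | node V ih => simp only [map, contour, map_bind, ih, Function.comp_def]

end SeqTree

theorem exists_contour_ge_copiesLim_iterLim {η : Ordinal.{0}} (hη : η < Ordinal.omega 1) :
    ∃ V : SeqTree, V.IsCascade ∧ V.IsMonotone ∧ V.rank = 1 + η ∧
      copiesLim (iterLim η) ≤ V.contour := by
  induction η using WellFoundedLT.induction with
  | ind η ih =>
    obtain rfl | h0 := eq_or_ne η 0
    · refine ⟨node leaf, ⟨fun _ => trivial, fun m n h => ?_⟩,
        ⟨fun _ => trivial, 1, fun _ _ _ => le_rfl⟩, ?_, fun A hA => ?_⟩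
      · simpa [SeqTree.max] using h
      · simp [rank]
      · rw [mem_contour_node] at hA
        obtain ⟨N, hN⟩ := eventually_atTop.1 hA
        rw [copiesLim, mem_bind']
        filter_upwards [eventually_ge_atTop N] with n hn
        refine mem_map.2 (univ_mem' fun x => ?_)
        simpa [contour] using hN (Nat.pair n x) (hn.trans (Nat.left_le_pair n x))
    · obtain ⟨f, hf, hfη, hcof⟩ := exists_monotone_cofinal_seq (pos_iff_ne_zero.2 h0) hη
      choose V hc hm hr hV using fun n => ih (f n) (hfη n) ((hfη n).trans hη)
      refine ⟨node fun n => (V n).map (Nat.pair n), ⟨fun n => (hc n).map ?_, fun m n h => ?_⟩,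
        ⟨fun n => (hm n).map _, 1, fun m n h => ?_⟩, ?_, fun A hA => ?_⟩
      · exact fun x y h => (Nat.pair_eq_pair.1 h).2
      · rw [max_map, max_map, disjoint_left]
        rintro _ ⟨x, -, rfl⟩ ⟨y, -, hy⟩
        exact h (Nat.pair_eq_pair.1 hy).1.symm
      · simp only [rank_map, hr, Equiv.Perm.one_apply]
        gcongr
        exact hf h
      · simp only [rank, rank_map, hr]
        refine le_antisymm (Ordinal.iSup_le fun n => ?_) (le_of_forall_lt fun b hb => ?_)
        · exact Order.succ_le_of_lt ((add_lt_add_iff_left 1).2 (hfη n))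
        · rw [Ordinal.lt_iSup_iff]
          by_cases h1 : 1 ≤ b
          · rw [← Ordinal.add_sub_cancel_of_le h1, add_lt_add_iff_left] at hb
            obtain ⟨n, hn⟩ := hcof _ hb
            refine ⟨n, Order.lt_succ_iff.2 ?_⟩
            rw [← Ordinal.add_sub_cancel_of_le h1]
            gcongr
          · exact ⟨0, Order.lt_succ_iff.2 ((not_le.1 h1).le.trans le_self_add)⟩
      · rw [mem_contour_node] at hA
        rw [copiesLim, mem_bind']
        filter_upwards [hA] with n hn
        rw [contour_map] at hn
        exact map_mono ((iterLim_le_copiesLim (hfη n)).trans (hV n)) hn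

theorem containsContourOfRank_of_le_iterLim {u : Ultrafilter ℕ} {δ β : Ordinal.{0}}
    (hu : (u : Filter ℕ) ≤ iterLim δ) (hδ : δ ≤ Ordinal.omega 1) (h1 : 1 ≤ β) (hβ : β < 1 + δ) :
    ContainsContourOfRank u β := by
  rw [← Ordinal.add_sub_cancel_of_le h1, add_lt_add_iff_left] at hβ
  obtain ⟨V, hc, hm, hr, hV⟩ := exists_contour_ge_copiesLim_iterLim (hβ.trans_le hδ)
  exact ⟨V, hc, hm, hr.trans (Ordinal.add_sub_cancel_of_le h1),
    fun A hA => hu (iterLim_le_copiesLim hβ (hV hA))⟩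


/-! ### Transfinite construction of the ultrafilter. -/

theorem SeqTree.cardinalMk_le_continuum : Cardinal.mk SeqTree ≤ Cardinal.continuum := by
  let β : ℕ ⊕ Unit → Type := Sum.elim (fun _ => Empty) fun _ => ℕ
  let F : (Σ a, β a → SeqTree) → SeqTree
    | ⟨Sum.inl x, _⟩ => leaf x
    | ⟨Sum.inr _, V⟩ => node V
  have hF : Function.Surjective (WType.elim (β := β) SeqTree F) := by
    intro V
    induction V with
    | leaf x => exact ⟨WType.mk (Sum.inl x) Empty.elim, rfl⟩
    | node V ih =>
      choose w hw using ih
      exact ⟨WType.mk (Sum.inr ()) w, congrArg node (funext hw)⟩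
  refine (Cardinal.mk_le_of_surjective hF).trans (WType.cardinalMk_le_of_le ?_)
  have h : ∀ a, Cardinal.continuum ^ Cardinal.mk (β a) ≤ Cardinal.continuum := by
    rintro (x | x)
    · simp [β, Cardinal.one_le_iff_pos, Cardinal.continuum_pos]
    · simp [β]
  refine (Cardinal.sum_le_sum _ _ h).trans ?_
  simp

theorem exists_finset_of_mem_inf_iInf_principal {X I : Type*} {H : Filter X} {A : I → Set X}
    {C : Set X} (h : C ∈ H ⊓ ⨅ i, 𝓟 (A i)) :
    ∃ t : Finset I, ∀ᶠ x in H, (∀ i ∈ t, x ∈ A i) → x ∈ C := by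
  obtain ⟨s, hs, s', hs', hsub⟩ := mem_inf_iff_superset.1 h
  obtain ⟨t, ht, hts⟩ := (hasBasis_iInf_principal_finite A).mem_iff.1 hs'
  refine ⟨ht.toFinset, mem_of_superset hs fun x hx hxt => hsub ⟨hx, hts ?_⟩⟩
  exact mem_iInter₂.2 fun i hi => hxt i (ht.mem_toFinset.2 hi)

theorem EscapesTails.exists_mem_contour_neBot {H : Filter ℕ} {α : Ordinal.{0}}
    (hH : EscapesTails H α) (hα : 1 ≤ α) {V : SeqTree} (hc : V.IsCascade) (hm : V.IsMonotone)
    (hr : α ≤ V.rank) (hb : Cardinal.aleph0 ≤ boundingNumber) {I : Type}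
    (hI : Cardinal.mk I < boundingNumber) (A : I → Set ℕ) (hA : (H ⊓ ⨅ i, 𝓟 (A i)).NeBot) :
    ∃ C ∈ V.contour, (H ⊓ (⨅ i, 𝓟 (A i)) ⊓ 𝓟 Cᶜ).NeBot := by
  obtain ⟨V, rfl⟩ := exists_eq_node_of_one_le_rank (hα.trans hr)
  by_contra! hcon
  have hle : ∀ C ∈ (node V).contour, C ∈ H ⊓ ⨅ i, 𝓟 (A i) := fun C hC =>
    mem_iff_inf_principal_compl.2 (hcon C hC)
  have hfin : Cardinal.mk (Finset I) < boundingNumber := by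
    cases finite_or_infinite I
    · exact (Cardinal.lt_aleph0_of_finite _).trans_le hb
    · rwa [Cardinal.mk_finset_of_infinite]
  have hpos : ∀ (t : Finset I) m, ∃ᶠ x in H, x ∈ {x | ∀ i ∈ t, x ∈ A i} ∩ tailMax V m := by
    intro t m
    have h1 : ∀ᶠ x in H ⊓ ⨅ i, 𝓟 (A i), ∀ i ∈ t, x ∈ A i :=
      (eventually_all_finset t).2 fun i _ =>
        inf_le_right (a := H) (mem_iInf_of_mem i (mem_principal_self _))
    exact (h1.and (hle _ (tailMax_mem_contour V m))).frequently.filter_mono inf_le_left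
  choose C hC hCf using fun t => hH V hc hm hr _ (hpos t)
  obtain ⟨D, hD, hDC⟩ := hc.exists_pseudointersection hfin C hC
  obtain ⟨t, ht⟩ := exists_finset_of_mem_inf_iInf_principal
    (hle D (mem_contour_node.2 (Eventually.of_forall hD)))
  obtain ⟨m, hm⟩ := hDC t
  obtain ⟨x, hx, hxD⟩ := ((hCf t m).and_eventually ht).exists
  exact hx.2 (hm ⟨hxD hx.1.1, hx.1.2⟩)

theorem neBot_inf_iInf_principal_of_initial {X ι : Type*} [LinearOrder ι] {H : Filter X} [H.NeBot]
    {C : ι → Set X} (s : Set ι)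
    (h : ∀ i ∈ s, (H ⊓ ⨅ j : Iic i, 𝓟 (C j)).NeBot) : (H ⊓ ⨅ j : s, 𝓟 (C j)).NeBot := by
  obtain rfl | hs := s.eq_empty_or_nonempty
  · simpa
  · have : Nonempty s := hs.to_subtype
    have hX : Nonempty X := H.nonempty_of_neBot
    have : (⨅ i : s, H ⊓ ⨅ j : Iic (i : ι), 𝓟 (C j)).NeBot := by
      refine iInf_neBot_of_directed (directed_of_isDirected_le fun i k hik => ?_)
        fun i => h i i.2
      exact inf_le_inf_left _ (le_iInf fun j => iInf_le (fun j : Iic (k : ι) => 𝓟 (C j))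
        ⟨j, (mem_Iic.1 j.2).trans hik⟩)
    refine this.mono (le_inf ?_ (le_iInf fun j => ?_))
    · exact (iInf_le _ (Classical.arbitrary s)).trans inf_le_left
    · exact (iInf_le _ j).trans (inf_le_right.trans
        (iInf_le (fun k : Iic (j : ι) => 𝓟 (C k)) ⟨j, le_rfl⟩))

/-- A filter which, when extended by fewer than `κ` sets, can always be extended further by a
member of each of the `κ` families `S w`, extends to an ultrafilter meeting all these families. -/
theorem exists_ultrafilter_forall_exists_mem {X W : Type} {H : Filter X} [H.NeBot]
    {κ : Cardinal.{0}} (hW : Cardinal.mk W ≤ κ) (S : W → Set (Set X))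
    (h : ∀ (I : Type) (A : I → Set X), Cardinal.mk I < κ → (H ⊓ ⨅ i, 𝓟 (A i)).NeBot →
      ∀ w, ∃ C ∈ S w, (H ⊓ (⨅ i, 𝓟 (A i)) ⊓ 𝓟 C).NeBot) :
    ∃ u : Ultrafilter X, (u : Filter X) ≤ H ∧ ∀ w, ∃ C ∈ S w, C ∈ u := by
  classical
  obtain ⟨e⟩ : Nonempty (W ↪ κ.ord.ToType) := by
    rw [← Cardinal.le_def]
    simpa using hW
  -- An index outside the range of `e` imposes no condition.
  let T : κ.ord.ToType → Set (Set X) := fun i => {C | ∀ w, e w = i → C ∈ S w}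
  have hT : ∀ i, ∀ (I : Type) (A : I → Set X), Cardinal.mk I < κ → (H ⊓ ⨅ i, 𝓟 (A i)).NeBot →
      ∃ C ∈ T i, (H ⊓ (⨅ i, 𝓟 (A i)) ⊓ 𝓟 C).NeBot := by
    intro i I A hI hA
    by_cases hi : ∃ w, e w = i
    · obtain ⟨w, rfl⟩ := hi
      obtain ⟨C, hC, hCA⟩ := h I A hI hA w
      exact ⟨C, fun w' hw' => e.injective hw' ▸ hC, hCA⟩
    · exact ⟨univ, fun w hw => absurd ⟨w, hw⟩ hi, by simpa using hA⟩
  let P : ∀ i : κ.ord.ToType, (Iio i → Set X) → Set X → Prop := fun i A C =>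
    C ∈ T i ∧ (H ⊓ (⨅ j, 𝓟 (A j)) ⊓ 𝓟 C).NeBot
  -- `epsilon` lets the recursion be defined before its steps are known to succeed; `hP` proves that
  -- they do.
  let C : κ.ord.ToType → Set X := WellFoundedLT.fix fun i prev =>
    Classical.epsilon (P i fun j => prev j j.2)
  have hC : ∀ i, C i = Classical.epsilon (P i fun j => C j) := fun i => WellFoundedLT.fix_eq _ i
  have hIic : ∀ i, H ⊓ (⨅ j : Iio i, 𝓟 (C j)) ⊓ 𝓟 (C i) = H ⊓ ⨅ j : Iic i, 𝓟 (C j) := by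
    intro i
    rw [iInf_subtype'' (Iio i) fun j => 𝓟 (C j), iInf_subtype'' (Iic i) fun j => 𝓟 (C j),
      ← Iio_insert, iInf_insert, inf_assoc, inf_comm (𝓟 (C i))]
  have hP : ∀ i, C i ∈ T i ∧ (H ⊓ ⨅ j : Iic i, 𝓟 (C j)).NeBot := by
    intro i
    induction i using WellFoundedLT.induction with
    | ind i ih =>
      have := neBot_inf_iInf_principal_of_initial (Iio i) fun j hj => (ih j hj).2
      have := Classical.epsilon_spec (hT i _ _ ((Cardinal.mk_Iio_lt i (by simp)).trans_eq (by simp)) this)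
      rw [← hIic]
      rw [← hC i] at this
      exact this
  have hne := neBot_inf_iInf_principal_of_initial univ fun i _ => (hP i).2
  refine ⟨Ultrafilter.of (H ⊓ ⨅ j : (univ : Set κ.ord.ToType), 𝓟 (C j)), (Ultrafilter.of_le _).trans inf_le_left, fun w =>
    ⟨C (e w), (hP (e w)).1 w rfl, ?_⟩⟩
  exact (Ultrafilter.of_le _).trans inf_le_right
    (mem_iInf_of_mem (⟨e w, mem_univ _⟩ : (univ : Set κ.ord.ToType)) (mem_principal_self _))

/-! ### The classes of the P-hierarchy. -/

theorem pure_mem_PClass_one (x : ℕ) : (pure x : Ultrafilter ℕ) ∈ PClass 1 := by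
  refine ⟨fun β h1 h => absurd h1 (not_le.2 h), ?_⟩
  rintro ⟨V, hc, hm, hr, hV⟩
  have hx : ∃ᶠ y in map (fun _ => x) (⊤ : Filter ℕ), y ∈ ({x} : Set ℕ) := by
    simp
  obtain ⟨C, hC, hf⟩ := escapes_map_top (fun _ => x) V hc hm hr.ge {x} hx
  obtain ⟨y, rfl, hy⟩ := hf.exists
  exact hy (Ultrafilter.mem_pure.1 (hV C hC))

theorem PClass_omega_one_nonempty : (PClass (Ordinal.omega 1)).Nonempty := by
  refine ⟨Ultrafilter.of (iterLim (Ordinal.omega 1)), fun β h1 h =>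
    containsContourOfRank_of_le_iterLim (Ultrafilter.of_le _) le_rfl h1
      (h.trans_le le_add_self), ?_⟩
  rintro ⟨V, -, -, hr, -⟩
  exact V.rank_lt_omega_one.ne hr

theorem PClass_one_add_nonempty (hbc : boundingNumber = Cardinal.continuum) {δ : Ordinal.{0}}
    (h0 : δ ≠ 0) (hδ : δ < Ordinal.omega 1) : (PClass (1 + δ)).Nonempty := by
  let W := {V : SeqTree // V.IsCascade ∧ V.IsMonotone ∧ V.rank = 1 + δ}
  obtain ⟨u, hu, hS⟩ := exists_ultrafilter_forall_exists_mem (H := iterLim δ) (W := W)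
    ((Cardinal.mk_subtype_le _).trans cardinalMk_le_continuum)
    (fun V => {C | Cᶜ ∈ V.1.contour}) <| by
      intro I A hI hA V
      obtain ⟨C, hC, hne⟩ := (escapesTails_iterLim h0 hδ).exists_mem_contour_neBot le_self_add
        V.2.1 V.2.2.1 V.2.2.2.ge (hbc ▸ Cardinal.aleph0_le_continuum) (hbc ▸ hI) A hA
      exact ⟨Cᶜ, by simpa using hC, hne⟩
  refine ⟨u, fun β h1 h => containsContourOfRank_of_le_iterLim hu hδ.le h1 h, ?_⟩
  rintro ⟨V, hc, hm, hr, hV⟩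
  obtain ⟨C, hC, hCu⟩ := hS ⟨V, hc, hm, hr⟩
  exact Ultrafilter.compl_mem_iff_notMem.1 (hV _ hC) hCu

theorem theorem2p25 (hbc : boundingNumber = Cardinal.continuum)
    (ξ : Ordinal.{0}) (h1 : 1 ≤ ξ) (hω₁ : ξ ≤ Ordinal.omega 1) :
    (PClass ξ).Nonempty := by
  obtain rfl | hω₁ := hω₁.eq_or_lt
  · exact PClass_omega_one_nonempty
  obtain rfl | h := eq_or_ne ξ 1
  · exact ⟨_, pure_mem_PClass_one 0⟩
  rw [← Ordinal.add_sub_cancel_of_le h1]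
  refine PClass_one_add_nonempty hbc (fun h0 => h ?_) ((Ordinal.sub_le_self _ _).trans_lt hω₁)
  rw [← Ordinal.add_sub_cancel_of_le h1, h0, add_zero]
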